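/- Let $\varphi:\mathcal X\times\mathcal X\to\mathbb R$ be a positive semi-definite kernel, $x_1,\dots,x_n\in\mathcal X$ ($n\ge 1$) points with $\varphi(x_i,x_i)>0$, and let $G\in\mathbb R^{n\times n}$, $G_{ij}=\frac1n\,\varphi(x_i,x_j)/\sqrt{\varphi(x_i,x_i)\varphi(x_j,x_j)}$, be the normalized kernel matrix, with eigenvalues $\lambda_1,\dots,\lambda_n\ge 0$, largest eigenvalue $\lambda_{\max}$ and smallest eigenvalue $\lambda_{\min}$. For real $\alpha>0$, $\alpha\neq 1$, let $$\mathbf S_\alpha(G)=\frac1{1-\alpha}\log_2\Big(\sum_{i=1}^n\lambda_i^\alpha\Big)$$ be the matrix-based Rényi entropy. Let $0<\epsilon<1/3$, $0<\delta<1$, $s=\lceil 8\ln(2/\delta)/\epsilon^2\rceil$, let $g_1,\dots,g_s$ be independent standard Gaussian vectors in $\mathbb R^n$, and let $$\tilde{\mathbf S}_\alpha(G)=\frac1{1-\alpha}\log_2\Big(\frac{\lambda_{\max}^\alpha}{s}\sum_{i=1}^s\sum_{k=0}^m\binom{\alpha}{k}\,g_i^\top\Big(\frac{G}{\lambda_{\max}}-I\Big)^k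 g_i\Big)$$ be the Taylor-series estimator of degree $$m=\Bigg\lceil\alpha+\begin{cases}W_0\Big(\kappa\beta\big(\tfrac{\Gamma(\alpha+1)}{\epsilon\pi}\big)^{1/(\alpha+1)}\Big)\Big/\beta & \text{if }\lambda_{\min}>0,\\[1ex]\big(\tfrac{n\,c_\alpha}{\epsilon\pi}\big)^{1/\alpha}&\text{if }\lambda_{\min}=0,\end{cases}\Bigg\rceil$$ where $\kappa=\lambda_{\max}/\lambda_{\min}$, $\beta=-\ln(1-1/\kappa)/(\alpha+1)$, $W_0$ is the principal branch of the Lambert $W$ function (the quotient $W_0(\cdot)/\beta$ is read as its limit $0$ when $\kappa=1$), and $c_\alpha=\Gamma(\alpha+1)$ if $\alpha\ge\frac12$, $c_\alpha=\Gamma(\alpha)$ if $\alpha<\frac12$. Then with probability at least $1-\delta$, $$\big|\mathbf S_\alpha(G)-\tilde{\mathbf S}_\alpha(G)\big|\le\Big|\frac1{1-\alpha}\log_2(1-3\epsilon)\Big|.$$ -/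

import Mathlib

open MeasureTheory ProbabilityTheory Matrix

noncomputable section

namespace RenyiTaylor

/-- A real-valued positive (semi-definite) kernel: every finite Gram matrix is symmetric positive
semi-definite. -/
def IsPositiveKernel {X : Type*} (φ : X → X → ℝ) : Prop :=
  ∀ (k : ℕ) (y : Fin k → X), (Matrix.of fun i j => φ (y i) (y j)).PosSemidef

/-- The normalized kernel matrix `G i j = (1/n) * K i j / √(K i i * K j j)`, `K i j = φ (x i) (x j)`. -/
def kernelMatrix {X : Type*} {n : ℕ} (φ : X → X → ℝ) (x : Fin n → X) :
    Matrix (Fin n) (Fin n) ℝ :=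
  Matrix.of fun i j => 1 / (n : ℝ) * (φ (x i) (x j) / √(φ (x i) (x i) * φ (x j) (x j)))

theorem kernelMatrix_isHermitian {X : Type*} {n : ℕ} {φ : X → X → ℝ} (hφ : IsPositiveKernel φ)
    (x : Fin n → X) : (kernelMatrix φ x).IsHermitian := by
  have h := (hφ n x).isHermitian
  ext i j
  have hij : φ (x j) (x i) = φ (x i) (x j) := by simpa using h.apply i j
  simp [kernelMatrix, hij, mul_comm]

variable {n : ℕ} {G : Matrix (Fin n) (Fin n) ℝ}

/-- The largest eigenvalue of a real symmetric matrix. -/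
def lambdaMax (hG : G.IsHermitian) : ℝ := ⨆ i, hG.eigenvalues i

/-- The smallest eigenvalue of a real symmetric matrix. -/
def lambdaMin (hG : G.IsHermitian) : ℝ := ⨅ i, hG.eigenvalues i

/-- The condition number `λ_max / λ_min` (only used when `λ_min > 0`). -/
def condNumber (hG : G.IsHermitian) : ℝ := lambdaMax hG / lambdaMin hG

/-- The matrix-based Rényi entropy `(1/(1-α)) log₂ (∑ᵢ λᵢ(G)^α)`. -/
def renyiEntropy (hG : G.IsHermitian) (α : ℝ) : ℝ :=
  1 / (1 - α) * Real.logb 2 (∑ i, hG.eigenvalues i ^ α)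

/-- The output of the Taylor-series estimator of degree `m` on the query vectors `g 0, …, g (s-1)`. -/
def taylorEstimate (hG : G.IsHermitian) (α : ℝ) (m : ℕ) {s : ℕ}
    (g : Fin s → EuclideanSpace ℝ (Fin n)) : ℝ :=
  1 / (1 - α) * Real.logb 2 (lambdaMax hG ^ α / s *
    ∑ i, ∑ k ∈ Finset.range (m + 1),
      Ring.choose α k * ((g i).ofLp ⬝ᵥ (((lambdaMax hG)⁻¹ • G - 1) ^ k *ᵥ (g i).ofLp)))

/-- The principal branch of the Lambert `W` function on `[-1/e, ∞)`: the solution `w ≥ -1` of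
`w * exp w = z`. -/
def lambertW0 (z : ℝ) : ℝ :=
  Function.invFunOn (fun w : ℝ => w * Real.exp w) (Set.Ici (-1)) z

/-- The number of random vectors `⌈8 ln(2/δ) / ε²⌉`. -/
def sampleSize (δ ε : ℝ) : ℕ := ⌈8 * Real.log (2 / δ) / ε ^ 2⌉₊

/-- `β = -log(1 - 1/κ) / (α + 1)`. -/
def betaParam (κ α : ℝ) : ℝ := -Real.log (1 - 1 / κ) / (α + 1)

/-- The degree in the full-rank case. For `κ = 1` one has `betaParam 1 α = 0` in Lean, so that the
quotient is `0`; this is also its limit as `κ → 1`. -/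
def fullRankDegree (κ α ε : ℝ) : ℕ :=
  ⌈α + lambertW0 (κ * betaParam κ α * (Real.Gamma (α + 1) / (ε * Real.pi)) ^ (1 / (α + 1)))
      / betaParam κ α⌉₊

/-- The Gamma factor in the rank-deficient degree. -/
def gammaFactor (α : ℝ) : ℝ :=
  if α < 1 / 2 then Real.Gamma α else Real.Gamma (α + 1)

/-- The degree in the rank-deficient case. -/
def rankDeficientDegree (n : ℕ) (α ε : ℝ) : ℕ :=
  ⌈α + (n * gammaFactor α / (ε * Real.pi)) ^ (1 / α)⌉₊

/-- The degree of the Taylor polynomial, according to whether `λ_min > 0` or `λ_min = 0`. -/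
def taylorDegree (hG : G.IsHermitian) (α ε : ℝ) : ℕ :=
  if 0 < lambdaMin hG then fullRankDegree (condNumber hG) α ε else rankDeficientDegree n α ε

end RenyiTaylor

end

noncomputable section

namespace RenyiTaylor

/-! ### Generalized binomial coefficients -/

/-! Diagonalize `G` and put `t i = λᵢ / λ_max ∈ [0, 1]`. Up to the common factor `λ_max ^ α`, the
entropy takes the logarithm of `T = ∑ t i ^ α`, while the estimator takes that of an average of `s`
independent weighted chi-square forms with weights `p i = taylorPoly α m (t i)`. It is enough that
this average lies between `(1 - 3ε) T` and `T / (1 - 3ε)` with probability at least `1 - δ`.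

The truncation error is controlled by the decay of generalized binomial coefficients
(`abs_choose_le`, from the reflection formula and log-convexity of Gamma). If `λ_min > 0`, the tail
is geometric and the Lambert function solves for the degree giving relative error `ε`
(`abs_remainder_fullRankDegree_le`). Otherwise the absolute series is summed by telescoping,
uniformly down to `t = 0` (`abs_remainder_le_abs_choose`); since `T ≥ 1`, absolute error is again
relative (`sum_abs_remainder_le`).

The random error is a Chernoff bound governed by `∑ |p i|` (`measure_sum_quadratic_ge_le`). When `α
< 1` the truncation error may be as large as `2εT`; the budget `3ε` still suffices because the
Taylor polynomials then overestimate `t ^ α` (`rpow_le_taylorPoly`). -/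

theorem choose_succ_mul (a : ℝ) (k : ℕ) :
    Ring.choose a (k + 1) * (k + 1) = Ring.choose a k * (a - k) := by
  have hk : (k.factorial : ℝ) ≠ 0 := by exact_mod_cast k.factorial_ne_zero
  have hk1 : (k : ℝ) + 1 ≠ 0 := by positivity
  simp only [Ring.choose_eq_smul, descPochhammer_succ_right, Polynomial.smeval_mul,
    Polynomial.smeval_sub, Polynomial.smeval_X, Polynomial.smeval_natCast, Nat.factorial_succ,
    smul_eq_mul, Nat.cast_mul, Nat.cast_add, Nat.cast_one, pow_one, pow_zero, nsmul_eq_mul, mul_one]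
  field_simp

theorem choose_succ_mul_eq (a : ℝ) (k : ℕ) :
    Ring.choose a (k + 1) * (k + 1) = a * Ring.choose (a - 1) k := by
  have h1 := choose_succ_mul (a - 1) k
  have h2 := Ring.choose_succ_succ (a - 1) k
  rw [sub_add_cancel] at h2
  rw [h2, add_mul, h1]
  ring

theorem sum_range_choose_mul_neg_one_pow (a : ℝ) (m : ℕ) :
    ∑ k ∈ Finset.range (m + 1), Ring.choose a k * (-1) ^ k =
      (-1) ^ m * Ring.choose (a - 1) m := by
  induction m with
  | zero => simp
  | succ m ih =>
    have h2 := Ring.choose_succ_succ (a - 1) m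
    rw [sub_add_cancel] at h2
    rw [Finset.sum_range_succ, ih, h2]
    ring

theorem neg_one_pow_mul_choose_nonneg {a : ℝ} (ha : a ≤ 0) (k : ℕ) :
    0 ≤ (-1) ^ k * Ring.choose a k := by
  induction k with
  | zero => simp
  | succ k ih =>
    have h := choose_succ_mul a k
    have hk : (0 : ℝ) < k + 1 := by positivity
    refine nonneg_of_mul_nonneg_left (b := (k : ℝ) + 1) ?_ hk
    have : (-1) ^ (k + 1) * Ring.choose a (k + 1) * ((k : ℝ) + 1) =
        ((-1) ^ k * Ring.choose a k) * (k - a) := by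
      rw [mul_assoc, h]; ring
    rw [this]
    exact mul_nonneg ih (by have : (0 : ℝ) ≤ k := k.cast_nonneg; linarith)

theorem neg_one_pow_mul_choose_succ_nonpos {a : ℝ} (ha : 0 ≤ a) (ha1 : a ≤ 1) (k : ℕ) :
    (-1) ^ (k + 1) * Ring.choose a (k + 1) ≤ 0 := by
  have h := choose_succ_mul_eq a k
  have hk : (0 : ℝ) < k + 1 := by positivity
  refine nonpos_of_mul_nonpos_left (b := (k : ℝ) + 1) ?_ hk
  have : (-1) ^ (k + 1) * Ring.choose a (k + 1) * ((k : ℝ) + 1) =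
      -(a * ((-1) ^ k * Ring.choose (a - 1) k)) := by
    rw [mul_assoc, h]; ring
  rw [this]
  have := mul_nonneg ha (neg_one_pow_mul_choose_nonneg (a := a - 1) (by linarith) k)
  linarith

/-- Pascal's rule: once `k + 1 ≥ a`, the two terms on its right have opposite signs (or one
vanishes). This makes the tail of `∑ |Ring.choose a k|` telescope. -/
theorem abs_choose_succ_eq_sub {a : ℝ} (ha : 0 ≤ a) {k : ℕ} (hk : a ≤ k + 1) :
    |Ring.choose a (k + 1)| = |Ring.choose (a - 1) k| - |Ring.choose (a - 1) (k + 1)| := by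
  have hk0 : (0 : ℝ) < k + 1 := by positivity
  have h1 := congrArg abs (choose_succ_mul_eq a k)
  have h2 := congrArg abs (choose_succ_mul (a - 1) k)
  rw [abs_mul, abs_mul, abs_of_pos hk0] at h1 h2
  rw [abs_of_nonneg ha] at h1
  rw [abs_of_nonpos (by linarith : a - 1 - k ≤ 0)] at h2
  refine mul_right_cancel₀ hk0.ne' ?_
  rw [sub_mul, h1, h2]
  ring

theorem sum_abs_choose_le {a : ℝ} (ha : 0 ≤ a) {m : ℕ} (hm : a ≤ m + 1) (N : ℕ) :
    ∑ j ∈ Finset.range N, |Ring.choose a (j + (m + 1))| ≤ |Ring.choose (a - 1) m| := by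
  suffices h : ∑ j ∈ Finset.range N, |Ring.choose a (j + (m + 1))| =
      |Ring.choose (a - 1) m| - |Ring.choose (a - 1) (N + m)| by
    rw [h]; linarith [abs_nonneg (Ring.choose (a - 1) (N + m))]
  induction N with
  | zero => simp
  | succ N ih =>
    have hN : (0 : ℝ) ≤ N := N.cast_nonneg
    rw [Finset.sum_range_succ, ih, ← add_assoc,
      abs_choose_succ_eq_sub ha (k := N + m) (by push_cast; linarith), Nat.add_right_comm]
    ring

/-- Log-convexity: the slope of `log Γ` over `[x - 1, x]` is `log (x - 1)`, and it is at most the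
slope over `[x, x + b]`. -/
theorem Gamma_mul_rpow_le {x b : ℝ} (hx : 1 < x) (hb : 0 ≤ b) :
    Real.Gamma x * (x - 1) ^ b ≤ Real.Gamma (x + b) := by
  rcases hb.eq_or_lt with rfl | hb
  · simp
  have hx1 : 0 < x - 1 := by linarith
  have h := Real.convexOn_log_Gamma.slope_mono_adjacent (x := x - 1) (y := x) (z := x + b)
    hx1 (show 0 < x + b by linarith) (by linarith) (by linarith)
  have hG : Real.Gamma x = (x - 1) * Real.Gamma (x - 1) := by
    simpa using Real.Gamma_add_one hx1.ne'
  have hG1 := Real.Gamma_pos_of_pos hx1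
  have hGx := Real.Gamma_pos_of_pos (show 0 < x by linarith)
  have hGb := Real.Gamma_pos_of_pos (show 0 < x + b by linarith)
  simp only [Function.comp_apply, sub_sub_cancel, div_one, add_sub_cancel_left] at h
  rw [le_div_iff₀ hb] at h
  have hl : Real.log (Real.Gamma x) - Real.log (Real.Gamma (x - 1)) = Real.log (x - 1) := by
    rw [hG, Real.log_mul hx1.ne' hG1.ne']; ring
  rw [hl] at h
  rw [← Real.log_le_log_iff (by positivity) hGb, Real.log_mul hGx.ne' (by positivity),
    Real.log_rpow hx1]
  linarith

theorem choose_mul_factorial_mul_Gamma {a : ℝ} (ha : ∀ k : ℕ, a ≠ k) (k : ℕ) :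
    Ring.choose a k * k.factorial * Real.Gamma (a + 1 - k) = Real.Gamma (a + 1) := by
  induction k with
  | zero => simp
  | succ k ih =>
    have h := choose_succ_mul a k
    have hG : Real.Gamma (a + 1 - k) = (a - k) * Real.Gamma (a - k) := by
      rw [← Real.Gamma_add_one (sub_ne_zero.2 (ha k))]; congr 1; ring
    have e : a + 1 - ((k + 1 : ℕ) : ℝ) = a - k := by push_cast; ring
    rw [e, ← ih, hG, Nat.factorial_succ]
    push_cast
    linear_combination (k.factorial : ℝ) * Real.Gamma (a - k) * h

/-- The reflection formula turns `1 / Γ(a + 1 - k)` into `Γ(k - a) sin(π(k - a)) / π`, and the sine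
is at most `1` in absolute value. For natural `a < k` the coefficient vanishes. -/
theorem abs_choose_mul_le {a : ℝ} (ha : -1 < a) {k : ℕ} (hk : a < k) :
    |Ring.choose a k| * k.factorial * Real.pi ≤ Real.Gamma (a + 1) * Real.Gamma (k - a) := by
  have hG1 := Real.Gamma_pos_of_pos (show 0 < a + 1 by linarith)
  have hG2 := Real.Gamma_pos_of_pos (show 0 < k - a by linarith)
  have hf : (0 : ℝ) < k.factorial := by exact_mod_cast k.factorial_pos
  by_cases h : ∀ j : ℕ, a ≠ j
  · have h1 := choose_mul_factorial_mul_Gamma h k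
    have h2 := Real.Gamma_mul_Gamma_one_sub (k - a)
    rw [show 1 - (k - a) = a + 1 - k by ring] at h2
    -- Division by zero gives `0`, so a vanishing sine would make one of the two Gamma values zero,
    -- against `hG2` or `h1`.
    have hs : Real.sin (Real.pi * (k - a)) ≠ 0 := by
      intro h0
      rw [h0, div_zero] at h2
      rcases mul_eq_zero.1 h2 with h3 | h3
      · exact hG2.ne' h3
      · rw [h3, mul_zero] at h1; exact hG1.ne h1
    rw [eq_div_iff hs] at h2
    have h3 : Ring.choose a k * k.factorial * Real.pi =
        Real.Gamma (a + 1) * Real.Gamma (k - a) * Real.sin (Real.pi * (k - a)) := by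
      linear_combination -(Ring.choose a k * k.factorial) * h2 +
        Real.Gamma (k - a) * Real.sin (Real.pi * (k - a)) * h1
    have h4 := congrArg abs h3
    rw [abs_mul, abs_mul, abs_of_pos hf, abs_of_pos Real.pi_pos, abs_mul,
      abs_of_pos (mul_pos hG1 hG2)] at h4
    rw [h4]
    exact mul_le_of_le_one_right (by positivity) (Real.abs_sin_le_one _)
  · push Not at h
    obtain ⟨j, rfl⟩ := h
    rw [Ring.choose_natCast, Nat.choose_eq_zero_of_lt (by exact_mod_cast hk)]
    simp only [Nat.cast_zero, abs_zero, zero_mul]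
    positivity

theorem abs_choose_le {a : ℝ} (ha : -1 < a) {k : ℕ} (hk : a + 1 < k) :
    |Ring.choose a k| ≤ Real.Gamma (a + 1) / (Real.pi * (k - a - 1) ^ (a + 1)) := by
  have h1 := abs_choose_mul_le ha (show a < k by linarith)
  have h2 := Gamma_mul_rpow_le (x := k - a) (b := a + 1) (by linarith) (by linarith)
  rw [show (k : ℝ) - a + (a + 1) = k + 1 by ring, Real.Gamma_nat_eq_factorial] at h2
  have hf : (0 : ℝ) < k.factorial := by exact_mod_cast k.factorial_pos
  have hG1 := Real.Gamma_pos_of_pos (show 0 < a + 1 by linarith)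
  have hG2 := Real.Gamma_pos_of_pos (show 0 < k - a by linarith)
  have hp : 0 < ((k : ℝ) - a - 1) ^ (a + 1) := Real.rpow_pos_of_pos (by linarith) _
  have hpi := Real.pi_pos
  rw [le_div_iff₀ (by positivity)]
  refine le_of_mul_le_mul_right ?_ hG2
  calc |Ring.choose a k| * (Real.pi * (k - a - 1) ^ (a + 1)) * Real.Gamma (k - a)
      = |Ring.choose a k| * Real.pi * (Real.Gamma (k - a) * (k - a - 1) ^ (a + 1)) := by ring
    _ ≤ |Ring.choose a k| * Real.pi * k.factorial := by gcongr
    _ ≤ _ := by linarith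

/-! ### The Taylor polynomial of `t ^ α` at `1` -/

/-- The Taylor polynomial of degree `m` of `t ↦ t ^ α` at `t = 1`. -/
def taylorPoly (α : ℝ) (m : ℕ) (t : ℝ) : ℝ :=
  ∑ k ∈ Finset.range (m + 1), Ring.choose α k * (t - 1) ^ k

theorem taylorPoly_one (α : ℝ) (m : ℕ) : taylorPoly α m 1 = 1 := by
  simp [taylorPoly, Finset.sum_range_succ']

theorem taylorPoly_zero (α : ℝ) (m : ℕ) :
    taylorPoly α m 0 = (-1) ^ m * Ring.choose (α - 1) m := by
  simpa [taylorPoly] using sum_range_choose_mul_neg_one_pow α m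

theorem hasSum_choose_mul_pow (α : ℝ) {t : ℝ} (ht0 : 0 < t) (ht1 : t ≤ 1) :
    HasSum (fun k : ℕ => Ring.choose α k * (t - 1) ^ k) (t ^ α) := by
  have h := (Real.one_add_rpow_hasFPowerSeriesOnBall_zero (a := α)).hasSum (y := t - 1) (by
    rw [← ENNReal.ofReal_one, Metric.eball_ofReal]
    simp only [Metric.mem_ball, dist_zero_right, Real.norm_eq_abs]
    rw [abs_lt]; constructor <;> linarith)
  simpa [binomialSeries, FormalMultilinearSeries.ofScalars_apply_eq, mul_comm] using h

theorem hasSum_remainder (α : ℝ) (m : ℕ) {t : ℝ} (ht0 : 0 < t) (ht1 : t ≤ 1) :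
    HasSum (fun j : ℕ => Ring.choose α (j + (m + 1)) * (t - 1) ^ (j + (m + 1)))
      (t ^ α - taylorPoly α m t) :=
  (hasSum_nat_add_iff' (m + 1)).2 (hasSum_choose_mul_pow α ht0 ht1)

theorem abs_remainder_le_abs_choose {α : ℝ} (hα : 0 < α) {m : ℕ} (hm : α ≤ m + 1) {t : ℝ}
    (ht0 : 0 ≤ t) (ht1 : t ≤ 1) :
    |t ^ α - taylorPoly α m t| ≤ |Ring.choose (α - 1) m| := by
  rcases ht0.eq_or_lt with rfl | ht0
  -- At `t = 0`, outside the open disc of convergence, the partial sum has a closed form and the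
  -- bound is an equality.
  · rw [Real.zero_rpow hα.ne', taylorPoly_zero, zero_sub, abs_neg, abs_mul, abs_pow, abs_neg,
      abs_one, one_pow, one_mul]
  · refine le_of_tendsto (hasSum_remainder α m ht0 ht1).tendsto_sum_nat.abs
      (Filter.Eventually.of_forall fun N => ?_)
    refine (Finset.abs_sum_le_sum_abs _ _).trans ((Finset.sum_le_sum fun j _ => ?_).trans
      (sum_abs_choose_le hα.le hm N))
    rw [abs_mul, abs_pow]
    refine mul_le_of_le_one_right (abs_nonneg _) (pow_le_one₀ (abs_nonneg _) ?_)
    rw [abs_le]; constructor <;> linarith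

theorem abs_remainder_le_geometric {α K : ℝ} {m : ℕ} {t : ℝ} (ht0 : 0 < t) (ht1 : t ≤ 1)
    (hK : ∀ k, m + 1 ≤ k → |Ring.choose α k| ≤ K) :
    |t ^ α - taylorPoly α m t| ≤ K * (1 - t) ^ (m + 1) / t := by
  have hg := (hasSum_geometric_of_lt_one (r := 1 - t) (by linarith) (by linarith)).mul_left
    (K * (1 - t) ^ (m + 1))
  rw [sub_sub_cancel, ← div_eq_mul_inv] at hg
  have h := hasSum_remainder α m ht0 ht1
  rw [← h.tsum_eq, ← Real.norm_eq_abs]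
  refine tsum_of_norm_bounded hg fun j => ?_
  rw [Real.norm_eq_abs, abs_mul, abs_pow, abs_sub_comm, abs_of_nonneg (by linarith : 0 ≤ 1 - t),
    mul_assoc, ← pow_add, Nat.add_comm (m + 1) j]
  exact mul_le_mul_of_nonneg_right (hK _ (by omega)) (pow_nonneg (by linarith) _)

/-- For `0 < α ≤ 1` every term of positive degree in the expansion at `1` is nonpositive on `[0,
1]`, so truncating can only increase the value. -/
theorem rpow_le_taylorPoly {α : ℝ} (hα : 0 < α) (hα1 : α ≤ 1) (m : ℕ) {t : ℝ}
    (ht0 : 0 ≤ t) (ht1 : t ≤ 1) : t ^ α ≤ taylorPoly α m t := by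
  rcases ht0.eq_or_lt with rfl | ht0
  · rw [Real.zero_rpow hα.ne', taylorPoly_zero]
    exact neg_one_pow_mul_choose_nonneg (by linarith) m
  · rw [← sub_nonpos]
    refine hasSum_le (fun j => ?_) (hasSum_remainder α m ht0 ht1) hasSum_zero
    rw [show t - 1 = -1 * (1 - t) by ring, mul_pow, ← mul_assoc, mul_comm (Ring.choose α _)]
    exact mul_nonpos_of_nonpos_of_nonneg (neg_one_pow_mul_choose_succ_nonpos hα.le hα1 (j + m))
      (pow_nonneg (by linarith) _)

/-! ### Remainder bounds for the two choices of the degree -/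

theorem lambertW0_spec {z : ℝ} (hz : 0 ≤ z) :
    -1 ≤ lambertW0 z ∧ lambertW0 z * Real.exp (lambertW0 z) = z := by
  have hex : ∃ w ∈ Set.Ici (-1 : ℝ), w * Real.exp w = z := by
    have hc : ContinuousOn (fun w : ℝ => w * Real.exp w) (Set.Icc 0 z) := by fun_prop
    obtain ⟨w, hw, h⟩ := intermediate_value_Icc hz hc
      (show z ∈ Set.Icc _ _ from ⟨by simpa using hz,
        le_mul_of_one_le_right hz (Real.one_le_exp hz)⟩)
    exact ⟨w, by have := hw.1; simp only [Set.mem_Ici]; linarith, h⟩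
  exact ⟨Function.invFunOn_mem hex, Function.invFunOn_eq hex⟩

theorem lambertW0_pos {z : ℝ} (hz : 0 < z) : 0 < lambertW0 z := by
  have h := (lambertW0_spec hz.le).2
  rw [← h] at hz
  exact pos_of_mul_pos_left hz (Real.exp_pos _).le

theorem abs_remainder_le_of_exp_eq {α ε κ y : ℝ} (hα : 0 < α) (hε : 0 < ε) (hκ : 1 < κ)
    (hy : 0 < y) (hyeq : y * Real.exp (betaParam κ α * y) =
      κ * (Real.Gamma (α + 1) / (ε * Real.pi)) ^ (1 / (α + 1)))
    {m : ℕ} (hm : α + y ≤ m) {t : ℝ} (ht : 1 / κ ≤ t) (ht1 : t ≤ 1) :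
    |t ^ α - taylorPoly α m t| ≤ ε * t ^ α := by
  have hκ0 : 0 < κ := by linarith
  have hpi := Real.pi_pos
  have hα1 : 0 < α + 1 := by linarith
  have hG := Real.Gamma_pos_of_pos hα1
  have hq : 0 < 1 - 1 / κ := by rw [sub_pos, div_lt_one hκ0]; exact hκ
  have hq1 : 1 - 1 / κ ≤ 1 := by have : 0 < 1 / κ := by positivity
                                 linarith
  have ht0 : 0 < t := lt_of_lt_of_le (by positivity) ht
  -- This is `hyeq` raised to the power `α + 1`, since `exp (betaParam κ α * (α + 1)) = (1 -
  -- 1/κ)⁻¹`. It says that the geometric tail bound equals `ε * t ^ α` at the worst point `t = 1/κ`.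
  have hpow : y ^ (α + 1) * (1 - 1 / κ) ^ (-y) =
      κ ^ (α + 1) * (Real.Gamma (α + 1) / (ε * Real.pi)) := by
    have h := congrArg (fun z : ℝ => z ^ (α + 1)) hyeq
    rw [Real.mul_rpow hy.le (Real.exp_pos _).le, Real.mul_rpow hκ0.le (by positivity),
      ← Real.rpow_mul (by positivity), one_div_mul_cancel hα1.ne', Real.rpow_one,
      ← Real.exp_mul] at h
    rw [← h, Real.rpow_def_of_pos hq, betaParam]
    congr 2
    field_simp
  have hbound : ∀ k, m + 1 ≤ k →
      |Ring.choose α k| ≤ Real.Gamma (α + 1) / (Real.pi * y ^ (α + 1)) := by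
    intro k hk
    have hk' : (m : ℝ) + 1 ≤ k := by exact_mod_cast hk
    refine (abs_choose_le (by linarith) (by linarith)).trans ?_
    gcongr
    linarith
  refine (abs_remainder_le_geometric ht0 ht1 hbound).trans ?_
  rw [div_le_iff₀ ht0, mul_assoc, ← Real.rpow_add_one ht0.ne', div_mul_eq_mul_div,
    div_le_iff₀ (by positivity)]
  have h1 : (1 - t) ^ (m + 1) ≤ (1 - 1 / κ) ^ y := by
    calc (1 - t) ^ (m + 1) ≤ (1 - 1 / κ) ^ (m + 1) := by
          gcongr
      _ = (1 - 1 / κ) ^ ((m : ℝ) + 1) := by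
          rw [← Real.rpow_natCast]; push_cast; rfl
      _ ≤ _ := Real.rpow_le_rpow_of_exponent_ge hq hq1 (by linarith)
  have h2 : (1 / κ) ^ (α + 1) ≤ t ^ (α + 1) := by gcongr
  have hκp : 0 < κ ^ (α + 1) := by positivity
  have hG' : Real.Gamma (α + 1) = ε * Real.pi * y ^ (α + 1) * (1 - 1 / κ) ^ (-y) *
      (1 / κ) ^ (α + 1) := by
    rw [Real.div_rpow zero_le_one hκ0.le, Real.one_rpow]
    field_simp at hpow ⊢
    linarith
  calc Real.Gamma (α + 1) * (1 - t) ^ (m + 1)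
      ≤ Real.Gamma (α + 1) * (1 - 1 / κ) ^ y := by gcongr
    _ = ε * Real.pi * y ^ (α + 1) * (1 / κ) ^ (α + 1) := by
        have := (Real.rpow_pos_of_pos hq y).ne'
        rw [hG', Real.rpow_neg hq.le, mul_right_comm, inv_mul_cancel_right₀ this]
    _ ≤ ε * Real.pi * y ^ (α + 1) * t ^ (α + 1) := by gcongr
    _ = _ := by ring

theorem abs_remainder_fullRankDegree_le {α ε κ : ℝ} (hα : 0 < α) (hε : 0 < ε) (hκ : 1 ≤ κ)
    {t : ℝ} (ht : 1 / κ ≤ t) (ht1 : t ≤ 1) :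
    |t ^ α - taylorPoly α (fullRankDegree κ α ε) t| ≤ ε * t ^ α := by
  rcases hκ.eq_or_lt with rfl | hκ
  -- Here the only admissible point is the centre of expansion, where every degree is exact.
  · obtain rfl : t = 1 := le_antisymm ht1 (by simpa using ht)
    simp [taylorPoly_one, hε.le]
  have hκ0 : 0 < κ := by linarith
  have hq : 0 < 1 - 1 / κ := by rw [sub_pos, div_lt_one hκ0]; exact hκ
  have hβ : 0 < betaParam κ α := by
    refine div_pos (neg_pos.2 (Real.log_neg hq ?_)) (by linarith)
    have : 0 < 1 / κ := by positivity
    linarith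
  have hG := Real.Gamma_pos_of_pos (show 0 < α + 1 by linarith)
  have hpi := Real.pi_pos
  set z := κ * betaParam κ α * (Real.Gamma (α + 1) / (ε * Real.pi)) ^ (1 / (α + 1)) with hz
  have hz0 : 0 < z := by positivity
  refine abs_remainder_le_of_exp_eq hα hε hκ (div_pos (lambertW0_pos hz0) hβ) ?_
    (Nat.le_ceil _) ht ht1
  rw [mul_div_cancel₀ _ hβ.ne', div_mul_eq_mul_div, (lambertW0_spec hz0.le).2, hz]
  field_simp

theorem gammaFactor_pos {α : ℝ} (hα : 0 < α) : 0 < gammaFactor α := by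
  unfold gammaFactor
  split_ifs
  · exact Real.Gamma_pos_of_pos hα
  · exact Real.Gamma_pos_of_pos (by linarith)

theorem card_mul_abs_remainder_rankDeficientDegree_le {α ε : ℝ} (hα : 0 < α) (hε : 0 < ε)
    {n : ℕ} (hn : 0 < n) {t : ℝ} (ht0 : 0 ≤ t) (ht1 : t ≤ 1) :
    n * |t ^ α - taylorPoly α (rankDeficientDegree n α ε) t| ≤
      ε * (Real.Gamma α / gammaFactor α) := by
  have hc := gammaFactor_pos hα
  have hG := Real.Gamma_pos_of_pos hα
  have hpi := Real.pi_pos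
  have hn' : (0 : ℝ) < n := by exact_mod_cast hn
  set w := (n * gammaFactor α / (ε * Real.pi)) ^ (1 / α) with hw
  have hw0 : 0 < w := by positivity
  have hm : α + w ≤ (rankDeficientDegree n α ε : ℝ) := Nat.le_ceil _
  set m := rankDeficientDegree n α ε
  have hwα : w ^ α = n * gammaFactor α / (ε * Real.pi) := by
    rw [hw, ← Real.rpow_mul (by positivity), one_div_mul_cancel hα.ne', Real.rpow_one]
  have h1 := abs_remainder_le_abs_choose hα (m := m) (by linarith) ht0 ht1
  have h2 := abs_choose_le (a := α - 1) (k := m) (by linarith) (by linarith)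
  rw [sub_add_cancel, show (m : ℝ) - (α - 1) - 1 = m - α by ring] at h2
  have h3 : Real.Gamma α / (Real.pi * (m - α) ^ α) ≤ Real.Gamma α / (Real.pi * w ^ α) := by
    gcongr
    linarith
  calc (n : ℝ) * |t ^ α - taylorPoly α m t|
      ≤ n * (Real.Gamma α / (Real.pi * w ^ α)) := by
        gcongr
        exact h1.trans (h2.trans h3)
    _ = _ := by rw [hwα]; field_simp

/-- The ratio is `1` below `1/2` and `1/α` from there on, so `2` is attained at `α = 1/2`. -/
theorem Gamma_div_gammaFactor_le_two {α : ℝ} (hα : 0 < α) :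
    Real.Gamma α / gammaFactor α ≤ 2 := by
  have hG := Real.Gamma_pos_of_pos hα
  rw [div_le_iff₀ (gammaFactor_pos hα)]
  unfold gammaFactor
  split_ifs with h
  · linarith
  · rw [Real.Gamma_add_one hα.ne']
    nlinarith

theorem Gamma_div_gammaFactor_le_one {α : ℝ} (hα : 1 ≤ α) :
    Real.Gamma α / gammaFactor α ≤ 1 := by
  have hα0 : 0 < α := by linarith
  have hG := Real.Gamma_pos_of_pos hα0
  rw [div_le_iff₀ (gammaFactor_pos hα0), gammaFactor, if_neg (by linarith),
    Real.Gamma_add_one hα0.ne']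
  nlinarith

/-! ### Concentration of Gaussian quadratic forms -/

/-- Equivalent to `-log (1 - y) ≤ y + y²`. The linear bound on `exp` leaves `1 - y³`, enough only
for `y ≤ 0`; positive `y` needs the quadratic one. -/
theorem one_le_one_sub_mul_exp {y : ℝ} (hy : |y| ≤ 1 / 2) :
    1 ≤ (1 - y) * Real.exp (y + y ^ 2) := by
  obtain ⟨h1, h2⟩ := abs_le.1 hy
  rcases le_total 0 y with h0 | h0
  · have h := Real.quadratic_le_exp_of_nonneg (x := y + y ^ 2) (by positivity)
    refine le_trans ?_ (mul_le_mul_of_nonneg_left h (by linarith))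
    have : 0 ≤ (1 - y) * (1 + y) ^ 2 - 2 * y := by nlinarith
    nlinarith [mul_nonneg (sq_nonneg y) this]
  · have h := Real.add_one_le_exp (y + y ^ 2)
    refine le_trans ?_ (mul_le_mul_of_nonneg_left h (by linarith))
    nlinarith [mul_nonneg (neg_nonneg.2 h0) (sq_nonneg y)]

theorem gaussianPDFReal_mul_exp_mul_sq (c x : ℝ) :
    gaussianPDFReal 0 1 x * Real.exp (c * x ^ 2) =
      (√(2 * Real.pi))⁻¹ * Real.exp (-(1 / 2 - c) * x ^ 2) := by
  simp only [gaussianPDFReal, NNReal.coe_one, mul_one, sub_zero]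
  rw [mul_assoc, ← Real.exp_add]
  ring_nf

theorem integrable_exp_mul_sq_gaussianReal {c : ℝ} (hc : c < 1 / 2) :
    Integrable (fun x => Real.exp (c * x ^ 2)) (gaussianReal 0 1) := by
  rw [gaussianReal_of_var_ne_zero _ one_ne_zero, gaussianPDF_def,
    integrable_withDensity_iff_integrable_smul' (by fun_prop) (by simp)]
  have h := (integrable_exp_neg_mul_sq (b := 1 / 2 - c) (by linarith)).const_mul
    (√(2 * Real.pi))⁻¹
  refine h.congr (Filter.Eventually.of_forall fun x => ?_)
  simp only [smul_eq_mul]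
  rw [ENNReal.toReal_ofReal (gaussianPDFReal_nonneg _ _ _), gaussianPDFReal_mul_exp_mul_sq]

theorem integral_exp_mul_sq_gaussianReal {c : ℝ} (hc : c < 1 / 2) :
    ∫ x, Real.exp (c * x ^ 2) ∂(gaussianReal 0 1) = (√(1 - 2 * c))⁻¹ := by
  rw [integral_gaussianReal_eq_integral_smul one_ne_zero]
  simp_rw [smul_eq_mul, gaussianPDFReal_mul_exp_mul_sq]
  rw [integral_const_mul, integral_gaussian, ← Real.sqrt_inv, ← Real.sqrt_inv,
    ← Real.sqrt_mul (by positivity)]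
  congr 1
  have : 1 / 2 - c ≠ 0 := by linarith
  have : 1 - 2 * c ≠ 0 := by linarith
  have := Real.pi_pos
  field_simp

theorem integral_exp_mul_sq_gaussianReal_le {c : ℝ} (hc : |c| ≤ 1 / 4) :
    ∫ x, Real.exp (c * x ^ 2) ∂(gaussianReal 0 1) ≤ Real.exp (c + 2 * c ^ 2) := by
  obtain ⟨h1, h2⟩ := abs_le.1 hc
  rw [integral_exp_mul_sq_gaussianReal (by linarith), inv_le_iff_one_le_mul₀
    (Real.sqrt_pos.2 (by linarith))]
  have h := one_le_one_sub_mul_exp (y := 2 * c) (by rw [abs_mul, abs_two]; linarith)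
  have he : Real.exp (2 * c + (2 * c) ^ 2) = Real.exp (c + 2 * c ^ 2) ^ 2 := by
    rw [← Real.exp_nat_mul]; congr 1; push_cast; ring
  rw [he] at h
  have h' := Real.sqrt_le_sqrt h
  rwa [Real.sqrt_one, Real.sqrt_mul (by linarith), Real.sqrt_sq (Real.exp_pos _).le,
    mul_comm] at h'

section QuadraticForm

variable {ι E Ω : Type*} [Fintype ι] [NormedAddCommGroup E] [InnerProductSpace ℝ E]

theorem exp_mul_quadratic_eq_prod (b : OrthonormalBasis ι ℝ E) (p : ι → ℝ) (θ : ℝ) (x : ι → ℝ) :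
    Real.exp (θ * ∑ i, p i * inner ℝ (b i) (∑ j, x j • b j) ^ 2) =
      ∏ i, Real.exp ((θ * p i) * x i ^ 2) := by
  rw [← Real.exp_sum, Finset.mul_sum]
  congr 1
  refine Finset.sum_congr rfl fun i _ => ?_
  rw [b.orthonormal.inner_right_fintype]
  ring

variable [FiniteDimensional ℝ E] [MeasurableSpace E] [BorelSpace E] [MeasurableSpace Ω]

theorem integrable_exp_mul_quadratic_stdGaussian (b : OrthonormalBasis ι ℝ E) {p : ι → ℝ} {θ : ℝ}
    (hθ : ∀ i, |θ * p i| ≤ 1 / 4) :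
    Integrable (fun v => Real.exp (θ * ∑ i, p i * inner ℝ (b i) v ^ 2)) (stdGaussian E) := by
  have hm : Measurable fun x : ι → ℝ => ∑ i, x i • b i := by fun_prop
  rw [stdGaussian_eq_map_pi_orthonormalBasis b, integrable_map_measure
    (by fun_prop) hm.aemeasurable]
  simp only [Function.comp_def, exp_mul_quadratic_eq_prod]
  exact Integrable.fintype_prod fun i =>
    integrable_exp_mul_sq_gaussianReal (by have := (abs_le.1 (hθ i)).2; linarith)

theorem integral_exp_mul_quadratic_stdGaussian_le (b : OrthonormalBasis ι ℝ E) {p : ι → ℝ} {θ : ℝ}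
    (hθ : ∀ i, |θ * p i| ≤ 1 / 4) :
    ∫ v, Real.exp (θ * ∑ i, p i * inner ℝ (b i) v ^ 2) ∂(stdGaussian E) ≤
      Real.exp (θ * ∑ i, p i + 2 * θ ^ 2 * ∑ i, p i ^ 2) := by
  have hm : Measurable fun x : ι → ℝ => ∑ i, x i • b i := by fun_prop
  rw [stdGaussian_eq_map_pi_orthonormalBasis b, integral_map hm.aemeasurable (by fun_prop)]
  simp only [exp_mul_quadratic_eq_prod]
  rw [integral_fintype_prod_eq_prod (fun i (y : ℝ) => Real.exp ((θ * p i) * y ^ 2))]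
  have : θ * ∑ i, p i + 2 * θ ^ 2 * ∑ i, p i ^ 2 = ∑ i, (θ * p i + 2 * (θ * p i) ^ 2) := by
    rw [Finset.sum_add_distrib, Finset.mul_sum, Finset.mul_sum]
    congr 1
    exact Finset.sum_congr rfl fun i _ => by ring
  rw [this, Real.exp_sum]
  exact Finset.prod_le_prod (fun i _ => integral_nonneg fun _ => (Real.exp_pos _).le)
    fun i _ => integral_exp_mul_sq_gaussianReal_le (hθ i)

/-- Chernoff's method: in an orthonormal basis the form is a weighted sum of independent squared
standard Gaussians, each with an explicit exponential moment. -/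
theorem measure_sum_quadratic_ge_le {μ : Measure Ω} [IsProbabilityMeasure μ] {s : ℕ}
    {g : Fin s → Ω → E} (hg : ∀ j, HasLaw (g j) (stdGaussian E) μ) (hind : iIndepFun g μ)
    (b : OrthonormalBasis ι ℝ E) (p : ι → ℝ) {B D : ℝ} (hB : 0 < B) (hp : ∑ i, |p i| ≤ B)
    (hD : 0 ≤ D) (hDB : D ≤ B) :
    μ.real {ω | s * (∑ i, p i + D) ≤ ∑ j, ∑ i, p i * inner ℝ (b i) (g j ω) ^ 2} ≤
      Real.exp (-(s * (D / B) ^ 2 / 8)) := by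
  -- The minimizer of `-θ D + 2 θ² B²`, with value `-(D/B)²/8`; `D ≤ B` keeps every `|θ * p i|`
  -- within the `1/4` that the moment bound requires.
  set θ := D / (4 * B ^ 2) with hθdef
  have hθ0 : 0 ≤ θ := by positivity
  have hpB : ∀ i, |p i| ≤ B := fun i =>
    (Finset.single_le_sum (fun j _ => abs_nonneg (p j)) (Finset.mem_univ i)).trans hp
  have hθB : θ * B ≤ 1 / 4 := by
    rw [hθdef, div_mul_eq_mul_div, div_le_iff₀ (by positivity)]
    nlinarith
  have hθ : ∀ i, |θ * p i| ≤ 1 / 4 := fun i => by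
    rw [abs_mul, abs_of_nonneg hθ0]
    exact (mul_le_mul_of_nonneg_left (hpB i) hθ0).trans hθB
  have hsq : ∑ i, p i ^ 2 ≤ B ^ 2 := by
    calc ∑ i, p i ^ 2 = ∑ i, |p i| ^ 2 := by simp
      _ ≤ (∑ i, |p i|) ^ 2 := Finset.sum_sq_le_sq_sum_of_nonneg fun i _ => abs_nonneg _
      _ ≤ B ^ 2 := by gcongr
  set X : Fin s → Ω → ℝ := fun j ω => ∑ i, p i * inner ℝ (b i) (g j ω) ^ 2 with hX
  have hfm : Measurable fun v : E => ∑ i, p i * inner ℝ (b i) v ^ 2 := by fun_prop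
  have hXm : ∀ j, AEMeasurable (X j) μ := fun j => hfm.comp_aemeasurable (hg j).aemeasurable
  have hXind : iIndepFun X μ := hind.comp (fun _ v => ∑ i, p i * inner ℝ (b i) v ^ 2) fun _ => hfm
  have hexp : ∀ j, Integrable (fun ω => Real.exp (θ * X j ω)) μ := fun j => by
    have h := integrable_exp_mul_quadratic_stdGaussian b hθ
    rw [← (hg j).map_eq] at h
    exact h.comp_aemeasurable (hg j).aemeasurable
  have hmgf : ∀ j, mgf (X j) μ θ ≤ Real.exp (θ * ∑ i, p i + 2 * θ ^ 2 * B ^ 2) := fun j => by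
    have h := integral_exp_mul_quadratic_stdGaussian_le b hθ
    rw [← (hg j).map_eq, integral_map (hg j).aemeasurable (by fun_prop)] at h
    refine h.trans (Real.exp_le_exp.2 ?_)
    gcongr
  have hsum := hXind.mgf_sum₀ hXm Finset.univ (t := θ)
  -- If not integrable, the integral would be `0` by convention, but it factors into positive
  -- moments.
  have hexpSum : Integrable (fun ω => Real.exp (θ * (∑ j, X j) ω)) μ := by
    by_contra h
    have h0 : mgf (∑ j, X j) μ θ = 0 := integral_undef h
    rw [hsum] at h0
    exact (Finset.prod_pos fun j _ => mgf_pos (hexp j)).ne' h0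
  have hch := measure_ge_le_exp_mul_mgf (s * (∑ i, p i + D)) hθ0 hexpSum
  simp only [Finset.sum_apply] at hch
  refine hch.trans ?_
  rw [hsum]
  calc Real.exp (-θ * (s * (∑ i, p i + D))) * ∏ j, mgf (X j) μ θ
      ≤ Real.exp (-θ * (s * (∑ i, p i + D))) *
          ∏ _j : Fin s, Real.exp (θ * ∑ i, p i + 2 * θ ^ 2 * B ^ 2) := by
        gcongr with j
        · exact fun j _ => mgf_nonneg
        · exact hmgf j
    _ = Real.exp (-(s * (D / B) ^ 2 / 8)) := by
        rw [Finset.prod_const, Finset.card_univ, Fintype.card_fin, ← Real.exp_nat_mul,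
          ← Real.exp_add, hθdef]
        congr 1
        field_simp
        ring

end QuadraticForm

theorem exp_neg_sampleSize_le {δ ε : ℝ} (hδ : 0 < δ) (hε : 0 < ε) :
    Real.exp (-(sampleSize δ ε * ε ^ 2 / 8)) ≤ δ / 2 := by
  have h : 8 * Real.log (2 / δ) / ε ^ 2 ≤ sampleSize δ ε := Nat.le_ceil _
  rw [div_le_iff₀ (by positivity)] at h
  calc Real.exp (-(sampleSize δ ε * ε ^ 2 / 8)) ≤ Real.exp (-Real.log (2 / δ)) :=
        Real.exp_le_exp.2 (by linarith)
    _ = δ / 2 := by rw [Real.exp_neg, Real.exp_log (by positivity), inv_div]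

theorem sampleSize_pos {δ ε : ℝ} (hδ : 0 < δ) (hδ1 : δ < 1) (hε : 0 < ε) :
    0 < sampleSize δ ε := by
  have : 0 < Real.log (2 / δ) := Real.log_pos (by rw [lt_div_iff₀ hδ]; linarith)
  exact Nat.ceil_pos.2 (by positivity)

/-- A union bound over two tails, the lower one being the upper tail for `-p`. The margins `D₁`,
`D₂` are kept separate because the truncation error can be one-sided. -/
theorem measure_quadratic_mem_Icc_ge {ι E Ω : Type*} [Fintype ι] [NormedAddCommGroup E]
    [InnerProductSpace ℝ E] [FiniteDimensional ℝ E] [MeasurableSpace E] [BorelSpace E]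
    [MeasurableSpace Ω] {μ : Measure Ω} [IsProbabilityMeasure μ] {δ ε : ℝ} (hδ : 0 < δ)
    (hε : 0 < ε) {g : Fin (sampleSize δ ε) → Ω → E} (hg : ∀ j, HasLaw (g j) (stdGaussian E) μ)
    (hind : iIndepFun g μ) (b : OrthonormalBasis ι ℝ E) (p : ι → ℝ) {B D₁ D₂ lo hi : ℝ}
    (hB : 0 < B) (hp : ∑ i, |p i| ≤ B) (hD₁ : ε * B ≤ D₁) (hD₁B : D₁ ≤ B) (hD₂ : ε * B ≤ D₂)
    (hD₂B : D₂ ≤ B) (hlo : lo ≤ ∑ i, p i - D₁) (hhi : ∑ i, p i + D₂ ≤ hi) :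
    1 - δ ≤ μ.real {ω |
      sampleSize δ ε * lo ≤ ∑ j, ∑ i, p i * inner ℝ (b i) (g j ω) ^ 2 ∧
      ∑ j, ∑ i, p i * inner ℝ (b i) (g j ω) ^ 2 ≤ sampleSize δ ε * hi} := by
  have htail : ∀ D, ε * B ≤ D → Real.exp (-(sampleSize δ ε * (D / B) ^ 2 / 8)) ≤ δ / 2 := by
    intro D hD
    refine le_trans (Real.exp_le_exp.2 ?_) (exp_neg_sampleSize_le hδ hε)
    have : ε ≤ D / B := by rwa [le_div_iff₀ hB]
    gcongr
  have hεB : 0 < ε * B := by positivity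
  have h₁ := (measure_sum_quadratic_ge_le hg hind b (fun i => -p i) hB (by simpa using hp)
    (hεB.le.trans hD₁) hD₁B).trans (htail D₁ hD₁)
  have h₂ := (measure_sum_quadratic_ge_le hg hind b p hB hp
    (hεB.le.trans hD₂) hD₂B).trans (htail D₂ hD₂)
  simp only [neg_mul, Finset.sum_neg_distrib] at h₁
  set S : Ω → ℝ := fun ω => ∑ j, ∑ i, p i * inner ℝ (b i) (g j ω) ^ 2
  set s : ℝ := (sampleSize δ ε : ℝ)
  have hs : 0 ≤ s := Nat.cast_nonneg _
  have hcover : (Set.univ : Set Ω) ⊆ {ω | s * lo ≤ S ω ∧ S ω ≤ s * hi} ∪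
      ({ω | s * (-∑ i, p i + D₁) ≤ -S ω} ∪ {ω | s * (∑ i, p i + D₂) ≤ S ω}) := by
    intro ω _
    by_cases hA : s * (-∑ i, p i + D₁) ≤ -S ω
    · exact Or.inr (Or.inl hA)
    by_cases hC : s * (∑ i, p i + D₂) ≤ S ω
    · exact Or.inr (Or.inr hC)
    push Not at hA hC
    refine Or.inl ⟨?_, ?_⟩
    · have := mul_le_mul_of_nonneg_left hlo hs
      linarith
    · have := mul_le_mul_of_nonneg_left hhi hs
      linarith
  have h := (measureReal_mono hcover (measure_ne_top μ _)).trans (measureReal_union_le _ _)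
  have h' := measureReal_union_le (μ := μ) {ω | s * (-∑ i, p i + D₁) ≤ -S ω}
    {ω | s * (∑ i, p i + D₂) ≤ S ω}
  rw [probReal_univ] at h
  linarith

theorem abs_mul_logb_sub_le {c L T R q : ℝ} (hL : 0 < L) (hT : 0 < T) (hq : 0 < q)
    (h1 : q * T ≤ R) (h2 : R ≤ T / q) :
    |c * Real.logb 2 (L * T) - c * Real.logb 2 (L * R)| ≤ |c * Real.logb 2 q| := by
  have hR : 0 < R := lt_of_lt_of_le (by positivity) h1
  rw [Real.logb_mul hL.ne' hT.ne', Real.logb_mul hL.ne' hR.ne', ← mul_sub, abs_mul, abs_mul]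
  refine mul_le_mul_of_nonneg_left ?_ (abs_nonneg _)
  have h1' := Real.logb_le_logb_of_le (b := 2) one_lt_two (by positivity) h1
  have h2' := Real.logb_le_logb_of_le (b := 2) one_lt_two hR h2
  rw [Real.logb_mul hq.ne' hT.ne'] at h1'
  rw [Real.logb_div hT.ne' hq.ne'] at h2'
  have := neg_le_abs (Real.logb 2 q)
  rw [abs_le]
  constructor <;> linarith

/-! ### Spectral reduction -/

variable {n : ℕ} {G : Matrix (Fin n) (Fin n) ℝ}

theorem eigenvalues_le_lambdaMax (hG : G.IsHermitian) (i : Fin n) :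
    hG.eigenvalues i ≤ lambdaMax hG :=
  le_ciSup (Set.finite_range _).bddAbove i

theorem lambdaMin_le_eigenvalues (hG : G.IsHermitian) (i : Fin n) :
    lambdaMin hG ≤ hG.eigenvalues i :=
  ciInf_le (Set.finite_range _).bddBelow i

theorem exists_eigenvalues_eq_lambdaMax (hn : 0 < n) (hG : G.IsHermitian) :
    ∃ i, hG.eigenvalues i = lambdaMax hG := by
  have : Nonempty (Fin n) := ⟨⟨0, hn⟩⟩
  exact exists_eq_ciSup_of_finite

theorem pow_mulVec_eigenvectorBasis (hG : G.IsHermitian) (c : ℝ) (k : ℕ) (i : Fin n) :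
    (c • G - 1) ^ k *ᵥ (hG.eigenvectorBasis i).ofLp =
      (c * hG.eigenvalues i - 1) ^ k • (hG.eigenvectorBasis i).ofLp := by
  induction k with
  | zero => simp
  | succ k ih =>
    rw [pow_succ, ← mulVec_mulVec, sub_mulVec, smul_mulVec, hG.mulVec_eigenvectorBasis,
      one_mulVec, smul_smul,
      show (c * hG.eigenvalues i) • (hG.eigenvectorBasis i).ofLp - (hG.eigenvectorBasis i).ofLp =
        (c * hG.eigenvalues i - 1) • (hG.eigenvectorBasis i).ofLp by rw [sub_smul, one_smul],
      mulVec_smul, ih, smul_smul, pow_succ, mul_comm]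

theorem dotProduct_pow_mulVec (hG : G.IsHermitian) (c : ℝ) (k : ℕ)
    (v : EuclideanSpace ℝ (Fin n)) :
    v.ofLp ⬝ᵥ ((c • G - 1) ^ k *ᵥ v.ofLp) =
      ∑ i, (c * hG.eigenvalues i - 1) ^ k * inner ℝ (hG.eigenvectorBasis i) v ^ 2 := by
  have hv : v.ofLp = ∑ i, inner ℝ (hG.eigenvectorBasis i) v • (hG.eigenvectorBasis i).ofLp := by
    conv_lhs => rw [← hG.eigenvectorBasis.sum_repr' v]
    simp
  have hM : (c • G - 1) ^ k *ᵥ v.ofLp = ∑ i, (c • G - 1) ^ k *ᵥ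
      (inner ℝ (hG.eigenvectorBasis i) v • (hG.eigenvectorBasis i).ofLp) := by
    rw [← mulVec_sum, ← hv]
  rw [hM, dotProduct_sum]
  refine Finset.sum_congr rfl fun i _ => ?_
  have hi : v.ofLp ⬝ᵥ (hG.eigenvectorBasis i).ofLp = inner ℝ (hG.eigenvectorBasis i) v := by
    simp [EuclideanSpace.inner_eq_star_dotProduct]
  rw [mulVec_smul, pow_mulVec_eigenvectorBasis, dotProduct_smul, dotProduct_smul, hi]
  simp only [smul_eq_mul]
  ring

theorem taylorEstimate_eq (hG : G.IsHermitian) (α : ℝ) (m : ℕ) {s : ℕ}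
    (g : Fin s → EuclideanSpace ℝ (Fin n)) :
    taylorEstimate hG α m g = 1 / (1 - α) * Real.logb 2 (lambdaMax hG ^ α *
      ((∑ j, ∑ i, taylorPoly α m ((lambdaMax hG)⁻¹ * hG.eigenvalues i) *
        inner ℝ (hG.eigenvectorBasis i) (g j) ^ 2) / s)) := by
  have h : ∀ j, ∑ k ∈ Finset.range (m + 1), Ring.choose α k *
      ((g j).ofLp ⬝ᵥ (((lambdaMax hG)⁻¹ • G - 1) ^ k *ᵥ (g j).ofLp)) =
      ∑ i, taylorPoly α m ((lambdaMax hG)⁻¹ * hG.eigenvalues i) *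
        inner ℝ (hG.eigenvectorBasis i) (g j) ^ 2 := fun j => by
    simp only [dotProduct_pow_mulVec hG, taylorPoly, Finset.sum_mul, Finset.mul_sum]
    rw [Finset.sum_comm]
    exact Finset.sum_congr rfl fun i _ => Finset.sum_congr rfl fun k _ => by ring
  simp only [taylorEstimate, h]
  rw [mul_div_assoc', div_mul_eq_mul_div (lambdaMax hG ^ α)]

theorem renyiEntropy_eq (hG : G.IsHermitian) (h0 : ∀ i, 0 ≤ hG.eigenvalues i)
    (hmax : 0 < lambdaMax hG) (α : ℝ) :
    renyiEntropy hG α = 1 / (1 - α) * Real.logb 2 (lambdaMax hG ^ α *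
      ∑ i, ((lambdaMax hG)⁻¹ * hG.eigenvalues i) ^ α) := by
  unfold renyiEntropy
  rw [Finset.mul_sum]
  congr 3 with i
  rw [← Real.mul_rpow hmax.le (mul_nonneg (inv_nonneg.2 hmax.le) (h0 i)),
    mul_inv_cancel_left₀ hmax.ne']

theorem sum_abs_remainder_le (hn : 0 < n) (hG : G.IsHermitian)
    (h0 : ∀ i, 0 ≤ hG.eigenvalues i) (hmax : 0 < lambdaMax hG) {α ε : ℝ} (hα : 0 < α)
    (hε : 0 < ε) :
    ∑ i, |((lambdaMax hG)⁻¹ * hG.eigenvalues i) ^ α -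
        taylorPoly α (taylorDegree hG α ε) ((lambdaMax hG)⁻¹ * hG.eigenvalues i)| ≤
      max 1 (Real.Gamma α / gammaFactor α) * ε *
        ∑ i, ((lambdaMax hG)⁻¹ * hG.eigenvalues i) ^ α := by
  set t : Fin n → ℝ := fun i => (lambdaMax hG)⁻¹ * hG.eigenvalues i with ht
  have ht0 : ∀ i, 0 ≤ t i := fun i => mul_nonneg (inv_nonneg.2 hmax.le) (h0 i)
  have ht1 : ∀ i, t i ≤ 1 := fun i => by
    rw [ht, inv_mul_le_iff₀ hmax, mul_one]; exact eigenvalues_le_lambdaMax hG i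
  obtain ⟨i₀, hi₀⟩ := exists_eigenvalues_eq_lambdaMax hn hG
  -- The top eigenvalue alone contributes `1`; this makes the absolute error of the rank-deficient
  -- case relative.
  have hT : 1 ≤ ∑ i, t i ^ α := by
    have h1 : t i₀ ^ α = 1 := by simp only [ht]; rw [hi₀, inv_mul_cancel₀ hmax.ne', Real.one_rpow]
    rw [← h1]
    exact Finset.single_le_sum (f := fun i => t i ^ α)
      (fun i _ => Real.rpow_nonneg (ht0 i) α) (Finset.mem_univ i₀)
  unfold taylorDegree
  split_ifs with hmin
  · have hκ : 1 ≤ condNumber hG := by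
      rw [condNumber, one_le_div hmin, ← hi₀]; exact lambdaMin_le_eigenvalues hG i₀
    calc ∑ i, |t i ^ α - taylorPoly α (fullRankDegree (condNumber hG) α ε) (t i)|
        ≤ ∑ i, ε * t i ^ α := Finset.sum_le_sum fun i _ =>
          abs_remainder_fullRankDegree_le hα hε hκ (by
            simp only [ht]
            rw [condNumber, one_div_div, div_eq_inv_mul]
            exact mul_le_mul_of_nonneg_left (lambdaMin_le_eigenvalues hG i)
              (inv_nonneg.2 hmax.le)) (ht1 i)
      _ = 1 * ε * ∑ i, t i ^ α := by rw [← Finset.mul_sum, one_mul]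
      _ ≤ _ := by gcongr; exact le_max_left _ _
  · have hn' : (0 : ℝ) < n := by exact_mod_cast hn
    calc ∑ i, |t i ^ α - taylorPoly α (rankDeficientDegree n α ε) (t i)|
        ≤ ∑ _i : Fin n, ε * (Real.Gamma α / gammaFactor α) / n :=
          Finset.sum_le_sum fun i _ => by
            rw [le_div_iff₀ hn', mul_comm]
            exact card_mul_abs_remainder_rankDeficientDegree_le hα hε hn (ht0 i) (ht1 i)
      _ = Real.Gamma α / gammaFactor α * ε * 1 := by
          rw [Finset.sum_const, Finset.card_univ, Fintype.card_fin, nsmul_eq_mul]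
          field_simp
      _ ≤ _ := by
          gcongr
          exact le_max_right _ _

theorem measure_abs_renyiEntropy_sub_taylorEstimate_le (hn : 0 < n) (hG : G.IsHermitian)
    (h0 : ∀ i, 0 ≤ hG.eigenvalues i) (hmax : 0 < lambdaMax hG)
    {α : ℝ} (hα : 0 < α) {ε : ℝ} (hε : 0 < ε) (hε3 : ε < 1 / 3)
    {δ : ℝ} (hδ : 0 < δ) (hδ1 : δ < 1)
    {Ω : Type*} [MeasurableSpace Ω] {μ : Measure Ω} [IsProbabilityMeasure μ]
    {g : Fin (sampleSize δ ε) → Ω → EuclideanSpace ℝ (Fin n)}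
    (hg : ∀ i, HasLaw (g i) (stdGaussian (EuclideanSpace ℝ (Fin n))) μ) (hind : iIndepFun g μ) :
    1 - δ ≤ μ.real {ω |
      |renyiEntropy hG α - taylorEstimate hG α (taylorDegree hG α ε) (fun i => g i ω)| ≤
        |1 / (1 - α) * Real.logb 2 (1 - 3 * ε)|} := by
  have hrem := sum_abs_remainder_le hn hG h0 hmax hα hε
  have hs : (0 : ℝ) < sampleSize δ ε := by exact_mod_cast sampleSize_pos hδ hδ1 hε
  set m := taylorDegree hG α ε
  set t : Fin n → ℝ := fun i => (lambdaMax hG)⁻¹ * hG.eigenvalues i with ht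
  have ht0 : ∀ i, 0 ≤ t i := fun i => mul_nonneg (inv_nonneg.2 hmax.le) (h0 i)
  have ht1 : ∀ i, t i ≤ 1 := fun i => by
    rw [ht, inv_mul_le_iff₀ hmax, mul_one]; exact eigenvalues_le_lambdaMax hG i
  set T := ∑ i, t i ^ α with hTdef
  set p : Fin n → ℝ := fun i => taylorPoly α m (t i) with hpdef
  change ∑ i, |t i ^ α - p i| ≤ _ at hrem
  have hT : 0 < T := by
    obtain ⟨i₀, hi₀⟩ := exists_eigenvalues_eq_lambdaMax hn hG
    refine Finset.sum_pos' (fun i _ => Real.rpow_nonneg (ht0 i) α) ⟨i₀, Finset.mem_univ _, ?_⟩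
    simp [ht, hi₀, inv_mul_cancel₀ hmax.ne']
  have hq : 0 < 1 - 3 * ε := by linarith
  have hdiff : |T - ∑ i, p i| ≤ ∑ i, |t i ^ α - p i| := by
    rw [hTdef, ← Finset.sum_sub_distrib]
    exact Finset.abs_sum_le_sum_abs _ _
  have habs : ∑ i, |p i| ≤ T + ∑ i, |t i ^ α - p i| := by
    rw [hTdef, ← Finset.sum_add_distrib]
    refine Finset.sum_le_sum fun i _ => ?_
    have h1 := abs_sub_abs_le_abs_sub (p i) (t i ^ α)
    rw [abs_of_nonneg (Real.rpow_nonneg (ht0 i) α), abs_sub_comm] at h1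
    linarith
  obtain ⟨hd1, hd2⟩ := abs_le.1 hdiff
  have hεT : 0 < ε * T := by positivity
  have hεεT : 0 < ε * (ε * T) := by positivity
  have hcub : 0 < ε * (ε * (ε * T)) := by positivity
  have hεT3 : ε * T < 1 / 3 * T := by gcongr
  have hεεT3 : ε * (ε * T) ≤ 1 / 3 * (ε * T) := by gcongr
  have key : 1 - δ ≤ μ.real {ω |
      sampleSize δ ε * ((1 - 3 * ε) * T) ≤
        ∑ j, ∑ i, p i * inner ℝ (hG.eigenvectorBasis i) (g j ω) ^ 2 ∧
      ∑ j, ∑ i, p i * inner ℝ (hG.eigenvectorBasis i) (g j ω) ^ 2 ≤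
        sampleSize δ ε * (T / (1 - 3 * ε))} := by
    -- With `u = 3ε` this is `1 + u + u² ≤ 1 / (1 - u)`.
    have hhi : T + 3 * (ε * T) + 9 * (ε * (ε * T)) ≤ T / (1 - 3 * ε) := by
      rw [le_div_iff₀ hq]
      linarith
    -- For `α ≤ 1`, truncation costs nothing below, so `D₁` takes the whole `3εT`; above, it may
    -- cost `2εT`, and the quadratic term of `hhi` leaves room for a fluctuation of `ε(1 + 2ε)T`.
    -- For `α ≥ 1`, truncation costs `εT` on either side, and `2εT` covers `ε(1 + ε)T`.
    rcases le_total α 1 with hα1 | hα1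
    · have hc : max 1 (Real.Gamma α / gammaFactor α) ≤ 2 :=
        max_le one_le_two (Gamma_div_gammaFactor_le_two hα)
      have hrem2 : ∑ i, |t i ^ α - p i| ≤ 2 * (ε * T) := by
        refine hrem.trans ?_
        rw [mul_assoc]
        gcongr
      have hpT : T ≤ ∑ i, p i :=
        Finset.sum_le_sum fun i _ => rpow_le_taylorPoly hα hα1 m (ht0 i) (ht1 i)
      refine measure_quadratic_mem_Icc_ge hδ hε hg hind hG.eigenvectorBasis p
        (B := T + 2 * (ε * T)) (D₁ := 3 * (ε * T)) (D₂ := ε * T + 9 * (ε * (ε * T)))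
        ?_ ?_ ?_ ?_ ?_ ?_ ?_ ?_ <;> linarith
    · have hc : max 1 (Real.Gamma α / gammaFactor α) ≤ 1 :=
        max_le le_rfl (Gamma_div_gammaFactor_le_one hα1)
      have hrem1 : ∑ i, |t i ^ α - p i| ≤ 1 * (ε * T) := by
        refine hrem.trans ?_
        rw [mul_assoc]
        gcongr
      refine measure_quadratic_mem_Icc_ge hδ hε hg hind hG.eigenvectorBasis p
        (B := T + ε * T) (D₁ := 2 * (ε * T)) (D₂ := 2 * (ε * T))
        ?_ ?_ ?_ ?_ ?_ ?_ ?_ ?_ <;> linarith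
  refine key.trans (measureReal_mono ?_ (measure_ne_top μ _))
  rintro ω ⟨hω1, hω2⟩
  simp only [Set.mem_ofPred_eq]
  rw [renyiEntropy_eq hG h0 hmax, taylorEstimate_eq]
  refine abs_mul_logb_sub_le (Real.rpow_pos_of_pos hmax α) hT hq ?_ ?_
  · rw [le_div_iff₀ hs, mul_comm]; exact hω1
  · rw [div_le_iff₀ hs, mul_comm]; exact hω2

/-! ### The normalized kernel matrix -/

/-- Normalization is a congruence of the Gram matrix by a diagonal matrix, scaled by `1/n`. -/
theorem kernelMatrix_posSemidef {X : Type*} {φ : X → X → ℝ} (hφ : IsPositiveKernel φ)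
    {x : Fin n → X} (hx : ∀ i, 0 < φ (x i) (x i)) : (kernelMatrix φ x).PosSemidef := by
  set d : Fin n → ℝ := fun i => (√(φ (x i) (x i)))⁻¹
  have h := ((hφ n x).mul_mul_conjTranspose_same (diagonal d)).smul
    (show (0 : ℝ) ≤ 1 / n by positivity)
  convert h using 1
  ext i j
  rw [Matrix.smul_apply, diagonal_conjTranspose, mul_diagonal, diagonal_mul]
  simp only [kernelMatrix, of_apply, smul_eq_mul, d, Pi.star_apply, star_trivial]
  rw [Real.sqrt_mul (hx i).le]
  field_simp

theorem trace_kernelMatrix {X : Type*} {φ : X → X → ℝ} (hn : 0 < n)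
    {x : Fin n → X} (hx : ∀ i, 0 < φ (x i) (x i)) : (kernelMatrix φ x).trace = 1 := by
  have hn' : (n : ℝ) ≠ 0 := by exact_mod_cast hn.ne'
  have h : ∀ i, kernelMatrix φ x i i = 1 / n := fun i => by
    simp only [kernelMatrix, of_apply]
    rw [Real.sqrt_mul_self (hx i).le, div_self (hx i).ne', mul_one]
  simp [trace, h, hn']

theorem lambdaMax_pos_of_trace_pos (hG : G.IsHermitian) (h : 0 < G.trace) :
    0 < lambdaMax hG := by
  rw [hG.trace_eq_sum_eigenvalues] at h
  obtain ⟨i, -, hi⟩ := Finset.exists_lt_of_sum_lt (s := Finset.univ) (f := fun _ => (0 : ℝ))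
    (g := fun i => hG.eigenvalues i) (by simpa using h)
  exact hi.trans_le (eigenvalues_le_lambdaMax hG i)

end RenyiTaylor

end

theorem theorem2 {X : Type*} (φ : X → X → ℝ) (hφ : RenyiTaylor.IsPositiveKernel φ)
    {n : ℕ} (hn : 0 < n) (x : Fin n → X) (hx : ∀ i, 0 < φ (x i) (x i))
    (α : ℝ) (hα : 0 < α) (hα1 : α ≠ 1)
    (ε : ℝ) (hε : 0 < ε) (hε3 : ε < 1 / 3)
    (δ : ℝ) (hδ : 0 < δ) (hδ1 : δ < 1)
    {Ω : Type*} [MeasurableSpace Ω] (μ : Measure Ω) [IsProbabilityMeasure μ]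
    (g : Fin (RenyiTaylor.sampleSize δ ε) → Ω → EuclideanSpace ℝ (Fin n))
    (hg : ∀ i, HasLaw (g i) (stdGaussian (EuclideanSpace ℝ (Fin n))) μ)
    (hind : iIndepFun g μ) :
    1 - δ ≤ μ.real {ω |
      |RenyiTaylor.renyiEntropy (RenyiTaylor.kernelMatrix_isHermitian hφ x) α -
        RenyiTaylor.taylorEstimate (RenyiTaylor.kernelMatrix_isHermitian hφ x) α
          (RenyiTaylor.taylorDegree (RenyiTaylor.kernelMatrix_isHermitian hφ x) α ε)
          (fun i => g i ω)| ≤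
        |1 / (1 - α) * Real.logb 2 (1 - 3 * ε)|} :=
  RenyiTaylor.measure_abs_renyiEntropy_sub_taylorEstimate_le hn _
    (RenyiTaylor.kernelMatrix_posSemidef hφ hx).eigenvalues_nonneg
    (RenyiTaylor.lambdaMax_pos_of_trace_pos _
      (by rw [RenyiTaylor.trace_kernelMatrix hn hx]; exact one_pos))
    hα hε hε3 hδ hδ1 hg hind
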